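/- An oracle assigns to each function $f:\mathbb{R}\to\mathbb{R}$ and each point $x\in\mathbb{R}$ a response $\mathbb{O}_f(x)$ in some (arbitrary) set; it is \emph{local} if $\mathbb{O}_f(x)=\mathbb{O}_g(x)$ whenever $f$ and $g$ agree on a neighborhood of $x$. A (possibly randomized) algorithm $\mathcal{A}$ interacting with $\mathbb{O}$ draws a random seed $\xi$ from an arbitrary probability space and, on the objective $f$, produces the iterates $x_t^{\mathcal{A}(f)}=\mathcal{A}^{(t)}\big(\xi,\mathbb{O}_f(x_1^{\mathcal{A}(f)}),\dots,\mathbb{O}_f(x_{t-1}^{\mathcal{A}(f)})\big)\in\mathbb{R}$, $t=1,2,\dots$, where the $\mathcal{A}^{(t)}$ are arbitrary maps such that, for every Lipschitz $f$ bounded from below, the iterates are random variables. For a Lipschitz function $h:\mathbb{R}\to\mathbb{R}$, let $\partial h(x)$ be the set of Clarke generalized derivatives of $h$ at $x$, that is, the convex hull of all limits $\lim_k h'(x_k)$ over sequences $x_k\to x$ of points at which $h$ is differentiable. \textbf{Proposition.} For every $T\in\mathbb{N}$ and every $\delta>0$ there is $\rho=\rho(T,\delta)>0$, depending only on $T$ and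 $\delta$, such that for every local oracle and every algorithm $\mathcal{A}$ interacting with it there exist a function $h:\mathbb{R}\to[0,\infty)$ and a point $x^*\in(0,1)$ with the following properties: \begin{itemize} \item $h$ is $2$-Lipschitz, $h(0)=1$, and $x^*$ is the unique global minimizer of $h$; \item for all $x\neq x^*$ and all $g\in\partial h(x)$, $|g|\geq 1$; \item the first $T$ iterates of $\mathcal{A}$ on $h$ satisfy $\Pr\big[\exists\, t\in\{1,\dots,T\}:\ |x_t^{\mathcal{A}(h)}-x^*|<\rho\big]<\delta$. \end{itemize} -/

import Mathlib

/-!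
An adversary maintains an interval `[a, b]` and a V-shaped function with its minimizer in the middle
of `[a, b]`. Before the `t`-th query it considers `N` disjoint subintervals of `[a, b]`: the query
made on the current function lies in one of them with probability at most `1 / N`, and the adversary
moves the minimizer there, changing the function only inside `[a, b]`. By locality, the answers to
earlier queries outside `[a, b]` do not change, so after `T` rounds the queries have met the
current interval with probability at most `T / N`.

Moving the bottom off centre while keeping equal values at both ends of `[a, b]` requires different
slopes on the two sides. If the new interval lies in the middle third, slopes proportional to the
opposite gaps remain within a factor two of each other.
-/

open Filter Topology

/-- The Clarke generalized derivative (as a set) of a Lipschitz function `f : ℝ → ℝ` at `x`: the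
convex hull of all limits of `f' (x k)` along sequences `x k → x` of differentiability points. -/
def clarkeDeriv (f : ℝ → ℝ) (x : ℝ) : Set ℝ :=
  convexHull ℝ {u : ℝ | ∃ s : ℕ → ℝ, (∀ k, DifferentiableAt ℝ f (s k)) ∧
    Tendsto s atTop (𝓝 x) ∧ Tendsto (fun k => deriv f (s k)) atTop (𝓝 u)}

/-- An oracle with responses in `R` (`O f x` is the response at the point `x` for the objective
`f`) is local if its response at `x` is the same for any two functions which agree on some
neighborhood of `x`. -/
def IsLocalOracle {R : Type*} (O : (ℝ → ℝ) → ℝ → R) : Prop :=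
  ∀ (x : ℝ) (f g : ℝ → ℝ), f =ᶠ[𝓝 x] g → O f x = O g x

/-- The iterates produced on the objective `f` by the algorithm whose `t`-th query rule `A t` maps
the responses to all the previous queries to the next query. Indices start at `0`, so the first
`T` iterates are those with index `t < T`. Randomized algorithms are handled by letting `A` depend
on a random seed. -/
def iterates {R : Type*} (O : (ℝ → ℝ) → ℝ → R) (A : (t : ℕ) → (Fin t → R) → ℝ) (f : ℝ → ℝ) :
    ℕ → ℝ
  | t => A t (fun i : Fin t => O f (iterates O A f i))

/-- All difference quotients of `f` between distinct points of `s` lie in `I`. This expresses bounds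
on the slope of `f` without assuming differentiability. -/
def SlopesIn (f : ℝ → ℝ) (s I : Set ℝ) : Prop :=
  ∀ ⦃x⦄, x ∈ s → ∀ ⦃y⦄, y ∈ s → x < y → slope f x y ∈ I

namespace SlopesIn

variable {f g : ℝ → ℝ} {s t I J : Set ℝ} {m M : ℝ}

theorem mono (h : SlopesIn f s I) (hts : t ⊆ s) (hIJ : I ⊆ J) : SlopesIn f t J :=
  fun _ hx _ hy hxy => hIJ (h (hts hx) (hts hy) hxy)

theorem congr (h : SlopesIn f s I) (hfg : Set.EqOn g f s) : SlopesIn g s I := by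
  intro x hx y hy hxy
  rw [slope_def_field, hfg hx, hfg hy, ← slope_def_field]
  exact h hx hy hxy

theorem Icc_iff :
    SlopesIn f s (Set.Icc m M) ↔
      ∀ ⦃x⦄, x ∈ s → ∀ ⦃y⦄, y ∈ s → x < y → f y - f x ∈ Set.Icc (m * (y - x)) (M * (y - x)) := by
  refine forall₅_congr fun x _ y _ hxy => ?_
  rw [slope_def_field, Set.mem_Icc, Set.mem_Icc, le_div_iff₀ (sub_pos.2 hxy),
    div_le_iff₀ (sub_pos.2 hxy)]

theorem sub_mem_Icc (h : SlopesIn f s (Set.Icc m M)) {x y : ℝ} (hx : x ∈ s) (hy : y ∈ s)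
    (hxy : x ≤ y) : f y - f x ∈ Set.Icc (m * (y - x)) (M * (y - x)) := by
  rcases hxy.eq_or_lt with rfl | hxy
  · simp
  · exact Icc_iff.1 h hx hy hxy

theorem affine {k c a : ℝ} (hk : k ∈ I) : SlopesIn (fun x => c + k * (x - a)) s I := by
  intro x _ y _ hxy
  have hslope : slope (fun x => c + k * (x - a)) x y = k := by
    rw [slope_def_field, div_eq_iff (sub_ne_zero.2 hxy.ne')]
    ring
  rwa [hslope]

protected theorem max (hf : SlopesIn f s (Set.Icc m M)) (hg : SlopesIn g s (Set.Icc m M)) :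
    SlopesIn (fun x => max (f x) (g x)) s (Set.Icc m M) := by
  refine Icc_iff.2 fun x hx y hy hxy => ?_
  obtain ⟨hfm, hfM⟩ := Icc_iff.1 hf hx hy hxy
  obtain ⟨hgm, hgM⟩ := Icc_iff.1 hg hx hy hxy
  constructor
  · have : max (f x) (g x) ≤ max (f y) (g y) - m * (y - x) :=
      max_le (by linarith [le_max_left (f y) (g y)]) (by linarith [le_max_right (f y) (g y)])
    linarith
  · have : max (f y) (g y) ≤ max (f x) (g x) + M * (y - x) :=
      max_le (by linarith [le_max_left (f x) (g x)]) (by linarith [le_max_right (f x) (g x)])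
    linarith

theorem union_right (hI : Convex ℝ I) (hs : SlopesIn f s I) (ht : SlopesIn f t I) {c : ℝ}
    (hsc : IsGreatest s c) (htc : IsLeast t c) : SlopesIn f (s ∪ t) I := by
  intro x hx y hy hxy
  rcases le_or_gt y c with hyc | hcy
  · have mem_s {z : ℝ} (hz : z ∈ s ∪ t) (hzc : z ≤ c) : z ∈ s :=
      hz.elim id fun hzt => hzc.antisymm (htc.2 hzt) ▸ hsc.1
    exact hs (mem_s hx (hxy.le.trans hyc)) (mem_s hy hyc) hxy
  rcases le_or_gt c x with hcx | hxc
  · have mem_t {z : ℝ} (hz : z ∈ s ∪ t) (hcz : c ≤ z) : z ∈ t :=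
      hz.elim (fun hzs => hcz.antisymm (hsc.2 hzs) ▸ htc.1) id
    exact ht (mem_t hx hcx) (mem_t hy (hcx.trans hxy.le)) hxy
  · have hxs : x ∈ s := hx.resolve_right fun hxt => hxc.not_ge (htc.2 hxt)
    have hyt : y ∈ t := hy.resolve_left fun hys => hcy.not_ge (hsc.2 hys)
    rw [← lineMap_slope_slope_sub_div_sub f x c y hxy.ne]
    refine hI.lineMap_mem (hs hxs hsc.1 hxc) (ht htc.1 hyt hcy) ⟨?_, ?_⟩
    · exact div_nonneg (by linarith) (by linarith)
    · exact div_le_one_of_le₀ (by linarith) (by linarith)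

theorem lipschitzOnWith {K : NNReal} (h : SlopesIn f s (Set.Icc (-K) K)) :
    LipschitzOnWith K f s := by
  have key {x y : ℝ} (hx : x ∈ s) (hy : y ∈ s) (hxy : x ≤ y) : dist (f x) (f y) ≤ K * dist x y := by
    obtain ⟨hlower, hupper⟩ := h.sub_mem_Icc hx hy hxy
    rw [dist_comm, dist_comm x, Real.dist_eq, Real.dist_eq, abs_of_nonneg (sub_nonneg.2 hxy),
      abs_le]
    constructor <;> linarith
  refine LipschitzOnWith.of_dist_le_mul fun x hx y hy => ?_
  rcases le_total x y with hxy | hyx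
  · exact key hx hy hxy
  · rw [dist_comm, dist_comm x]
    exact key hy hx hyx

theorem deriv_mem (h : SlopesIn f s I) (hI : IsClosed I) {x : ℝ} (hs : s ∈ 𝓝 x)
    (hf : DifferentiableAt ℝ f x) : deriv f x ∈ I := by
  refine hI.mem_of_tendsto hf.hasDerivAt.tendsto_slope ?_
  filter_upwards [self_mem_nhdsWithin, mem_nhdsWithin_of_mem_nhds hs] with y hyx hy
  have hx := mem_of_mem_nhds hs
  rcases lt_or_gt_of_ne hyx with hlt | hgt
  · exact slope_comm f x y ▸ h hy hx hlt
  · exact h hx hy hgt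

theorem clarkeDeriv_subset (h : SlopesIn f s I) (hI : IsClosed I) (hI' : Convex ℝ I) {x : ℝ}
    (hs : s ∈ 𝓝 x) : clarkeDeriv f x ⊆ I := by
  refine convexHull_min ?_ hI'
  rintro u ⟨z, hz, hzx, hu⟩
  refine hI.mem_of_tendsto hu ?_
  filter_upwards [hzx.eventually (eventually_mem_nhds_iff.2 hs)] with k hk
  exact h.deriv_mem hI hk (hz k)

end SlopesIn

/-- `f` is a V-shaped function with bottom at `c`: it decreases with slopes in `[-2, -1]` before `c`
and increases with slopes in `[1, 2]` after `c`. -/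
structure IsSteepValley (f : ℝ → ℝ) (c : ℝ) : Prop where
  decr : SlopesIn f (Set.Iic c) (Set.Icc (-2) (-1))
  incr : SlopesIn f (Set.Ici c) (Set.Icc 1 2)

namespace IsSteepValley

variable {f g : ℝ → ℝ} {c : ℝ}

theorem lipschitzWith (h : IsSteepValley f c) : LipschitzWith 2 f := by
  have hslopes : SlopesIn f (Set.Iic c ∪ Set.Ici c) (Set.Icc (-(2 : NNReal)) (2 : NNReal)) :=
    (h.decr.mono subset_rfl (Set.Icc_subset_Icc (by norm_num) (by norm_num))).union_right
      (convex_Icc _ _) (h.incr.mono subset_rfl (Set.Icc_subset_Icc (by norm_num) (by norm_num)))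
      isGreatest_Iic isLeast_Ici
  rw [Set.Iic_union_Ici] at hslopes
  exact lipschitzOnWith_univ.1 hslopes.lipschitzOnWith

theorem apply_lt (h : IsSteepValley f c) {x : ℝ} (hx : x ≠ c) : f c < f x := by
  rcases lt_or_gt_of_ne hx with hxc | hcx
  · linarith [(h.decr.sub_mem_Icc hxc.le Set.self_mem_Iic hxc.le).2]
  · linarith [(h.incr.sub_mem_Icc Set.self_mem_Ici hcx.le hcx.le).1]

theorem apply_le (h : IsSteepValley f c) (x : ℝ) : f c ≤ f x := by
  rcases eq_or_ne x c with rfl | hx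
  exacts [le_rfl, (h.apply_lt hx).le]

theorem one_le_abs_of_mem_clarkeDeriv (h : IsSteepValley f c) {x : ℝ} (hx : x ≠ c) {u : ℝ}
    (hu : u ∈ clarkeDeriv f x) : 1 ≤ |u| := by
  rcases lt_or_gt_of_ne hx with hxc | hcx
  · have hmem := h.decr.clarkeDeriv_subset isClosed_Icc (convex_Icc _ _) (Iic_mem_nhds hxc) hu
    exact le_abs.2 (Or.inr (by linarith [hmem.2]))
  · have hmem := h.incr.clarkeDeriv_subset isClosed_Icc (convex_Icc _ _) (Ici_mem_nhds hcx) hu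
    exact le_abs.2 (Or.inl hmem.1)

theorem max_of_eq (hf : SlopesIn f Set.univ (Set.Icc (-2) (-1)))
    (hg : SlopesIn g Set.univ (Set.Icc 1 2)) (hc : f c = g c) :
    IsSteepValley (fun x => max (f x) (g x)) c where
  decr := (hf.mono (Set.subset_univ _) subset_rfl).congr fun x (hx : x ≤ c) => by
    have hfx := (hf.sub_mem_Icc (Set.mem_univ x) (Set.mem_univ c) hx).2
    have hgx := (hg.sub_mem_Icc (Set.mem_univ x) (Set.mem_univ c) hx).1
    exact max_eq_left (by linarith)
  incr := (hg.mono (Set.subset_univ _) subset_rfl).congr fun x (hx : c ≤ x) => by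
    have hfx := (hf.sub_mem_Icc (Set.mem_univ c) (Set.mem_univ x) hx).2
    have hgx := (hg.sub_mem_Icc (Set.mem_univ c) (Set.mem_univ x) hx).1
    exact max_eq_right (by linarith)

end IsSteepValley

theorem eqOn_piecewise_Icc_compl_Ioo {α β : Type*} [PartialOrder α] {a b : α}
    [DecidablePred (· ∈ Set.Icc a b)] {f g : α → β} (ha : g a = f a) (hb : g b = f b) :
    Set.EqOn ((Set.Icc a b).piecewise g f) f (Set.Ioo a b)ᶜ := by
  intro x hx
  by_cases hxab : x ∈ Set.Icc a b
  · rw [Set.piecewise_eq_of_mem _ _ _ hxab]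
    rcases Set.eq_endpoints_or_mem_Ioo_of_mem_Icc hxab with rfl | rfl | hmem
    exacts [ha, hb, absurd hmem hx]
  · exact Set.piecewise_eq_of_notMem _ _ _ hxab

theorem IsSteepValley.piecewise_Icc {f g : ℝ → ℝ} {a b c d : ℝ} (hf : IsSteepValley f c)
    (hg : IsSteepValley g d) (hc : c ∈ Set.Icc a b) (hd : d ∈ Set.Icc a b) (ha : g a = f a)
    (hb : g b = f b) : IsSteepValley ((Set.Icc a b).piecewise g f) d := by
  have hout := eqOn_piecewise_Icc_compl_Ioo ha hb
  have hin := Set.piecewise_eqOn (Set.Icc a b) g f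
  constructor
  · rw [← Set.Iic_union_Icc_eq_Iic hd.1]
    refine SlopesIn.union_right (convex_Icc _ _) ?_ ?_ isGreatest_Iic (isLeast_Icc hd.1)
    · exact (hf.decr.mono (Set.Iic_subset_Iic.2 hc.1) subset_rfl).congr
        (hout.mono fun x hx (hx' : x ∈ Set.Ioo a b) => hx'.1.not_ge hx)
    · exact (hg.decr.mono Set.Icc_subset_Iic_self subset_rfl).congr
        (hin.mono (Set.Icc_subset_Icc_right hd.2))
  · rw [← Set.Icc_union_Ici_eq_Ici hd.2]
    refine SlopesIn.union_right (convex_Icc _ _) ?_ ?_ (isGreatest_Icc hd.2) isLeast_Ici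
    · exact (hg.incr.mono Set.Icc_subset_Ici_self subset_rfl).congr
        (hin.mono (Set.Icc_subset_Icc_left hd.1))
    · exact (hf.incr.mono (Set.Ici_subset_Ici.2 hc.2) subset_rfl).congr
        (hout.mono fun x hx (hx' : x ∈ Set.Ioo a b) => hx'.2.not_ge hx)

theorem exists_slopes_of_mem_middle_third {a b a' b' : ℝ} (hlt : a' < b')
    (ha : (b - a) / 3 ≤ a' - a) (hb : (b - a) / 3 ≤ b - b') :
    ∃ σ ∈ Set.Icc (1 : ℝ) 2, ∃ τ ∈ Set.Icc (1 : ℝ) 2, σ * (a' - a) = τ * (b - b') := by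
  have hab : 0 < b - a := by linarith
  have hmem {l : ℝ} (h1 : (b - a) / 3 ≤ l) (h2 : l ≤ 2 * (b - a) / 3) :
      3 * l / (b - a) ∈ Set.Icc (1 : ℝ) 2 := by
    rw [Set.mem_Icc, le_div_iff₀ hab, div_le_iff₀ hab]
    constructor <;> linarith
  exact ⟨3 * (b - b') / (b - a), hmem hb (by linarith), 3 * (a' - a) / (b - a),
    hmem ha (by linarith), by ring⟩

theorem exists_isSteepValley_of_mem_middle_third {a b a' b' : ℝ} (v : ℝ) (hlt : a' < b')
    (ha : (b - a) / 3 ≤ a' - a) (hb : (b - a) / 3 ≤ b - b') :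
    ∃ g, IsSteepValley g ((a' + b') / 2) ∧ g a = v ∧ g b = v ∧ g a' = g b' := by
  obtain ⟨σ, ⟨hσ1, hσ2⟩, τ, ⟨hτ1, hτ2⟩, hdrop⟩ := exists_slopes_of_mem_middle_third hlt ha hb
  have : a < a' := by linarith
  have : b' < b := by linarith
  -- Both sides descend from `v` to `w` before `[a', b']`, inside which the slopes are `±1`.
  set w := v - σ * (a' - a)
  have hwv : w ≤ v := by nlinarith
  set p : ℝ → ℝ := fun x => max (v + -σ * (x - a)) (w + -1 * (x - a')) with hp
  set q : ℝ → ℝ := fun x => max (v + τ * (x - b)) (w + 1 * (x - b')) with hq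
  have hpslopes : SlopesIn p Set.univ (Set.Icc (-2) (-1)) :=
    SlopesIn.max (.affine ⟨by linarith, by linarith⟩) (.affine ⟨by norm_num, le_rfl⟩)
  have hqslopes : SlopesIn q Set.univ (Set.Icc 1 2) :=
    SlopesIn.max (.affine ⟨hτ1, hτ2⟩) (.affine ⟨le_rfl, by norm_num⟩)
  have hp_outer : p a = v := by simp only [hp]; rw [max_eq_left] <;> nlinarith
  have hq_outer : q b = v := by simp only [hq]; rw [max_eq_left] <;> nlinarith
  have hp_inner {x : ℝ} (hx : a' ≤ x) : p x = w - (x - a') := by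
    simp only [hp]; rw [max_eq_right] <;> nlinarith
  have hq_inner {x : ℝ} (hx : x ≤ b') : q x = w - (b' - x) := by
    simp only [hq]; rw [max_eq_right] <;> nlinarith
  refine ⟨_, IsSteepValley.max_of_eq hpslopes hqslopes ?_, ?_, ?_, ?_⟩
  · rw [hp_inner (by linarith), hq_inner (by linarith)]
    ring
  · rw [hp_outer, hq_inner (by linarith), max_eq_left (by linarith)]
  · rw [hq_outer, hp_inner (by linarith), max_eq_right (by linarith)]
  · rw [hp_inner le_rfl, hp_inner hlt.le, hq_inner hlt.le, hq_inner le_rfl, sub_self, sub_self,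
      max_comm]

/-- A state of the adversary: the current interval `[a, b] ⊆ [0, 1]` and a V-shaped function `f`
with its bottom in the middle of the interval. Later moves change `f` only inside `[a, b]`. The
values at `0` and `1` keep `f` nonnegative, as its slopes are at most `2` in absolute value. -/
structure IsAdversaryState (f : ℝ → ℝ) (a b : ℝ) : Prop where
  isSteepValley : IsSteepValley f ((a + b) / 2)
  left_lt_right : a < b
  left_nonneg : 0 ≤ a
  right_le_one : b ≤ 1
  apply_left_eq_apply_right : f a = f b
  apply_zero : f 0 = 1
  apply_one : f 1 = 1

namespace IsAdversaryState

variable {f : ℝ → ℝ} {a b : ℝ}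

theorem initial : IsAdversaryState (fun x => max (1 + -1 * (x - 0)) (0 + 1 * (x - 0))) 0 1 where
  isSteepValley := IsSteepValley.max_of_eq (SlopesIn.affine ⟨by norm_num, le_rfl⟩)
    (SlopesIn.affine ⟨le_rfl, by norm_num⟩) (by norm_num)
  left_lt_right := one_pos
  left_nonneg := le_rfl
  right_le_one := le_rfl
  apply_left_eq_apply_right := by norm_num
  apply_zero := by norm_num
  apply_one := by norm_num

theorem midpoint_mem_Ioo (h : IsAdversaryState f a b) : (a + b) / 2 ∈ Set.Ioo 0 1 := by
  have := h.left_lt_right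
  have := h.left_nonneg
  have := h.right_le_one
  constructor <;> linarith

theorem apply_nonneg (h : IsAdversaryState f a b) (x : ℝ) : 0 ≤ f x := by
  obtain ⟨hpos, hlt⟩ := h.midpoint_mem_Ioo
  have hleft := (h.isSteepValley.decr.sub_mem_Icc hpos.le Set.self_mem_Iic hpos.le).1
  have hright := (h.isSteepValley.incr.sub_mem_Icc Set.self_mem_Ici hlt.le hlt.le).2
  rw [h.apply_zero] at hleft
  rw [h.apply_one] at hright
  exact le_trans (by linarith) (h.isSteepValley.apply_le x)

theorem exists_refinement (h : IsAdversaryState f a b) {a' b' : ℝ} (hlt : a' < b')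
    (ha : (b - a) / 3 ≤ a' - a) (hb : (b - a) / 3 ≤ b - b') :
    ∃ g, IsAdversaryState g a' b' ∧ Set.EqOn g f (Set.Icc a b)ᶜ := by
  obtain ⟨g, hg, hga, hgb, hgab⟩ := exists_isSteepValley_of_mem_middle_third (f a) hlt ha hb
  rw [h.apply_left_eq_apply_right] at hgb
  have := h.left_lt_right
  have ha0 := h.left_nonneg
  have hb1 := h.right_le_one
  have hout := eqOn_piecewise_Icc_compl_Ioo hga hgb
  refine ⟨(Set.Icc a b).piecewise g f, ⟨?_, hlt, by linarith, by linarith, ?_, ?_, ?_⟩,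
    Set.piecewise_eqOn_compl _ _ _⟩
  · exact h.isSteepValley.piecewise_Icc hg ⟨by linarith, by linarith⟩
      ⟨by linarith, by linarith⟩ hga hgb
  · rwa [Set.piecewise_eq_of_mem _ _ _ (Set.mem_Icc.2 ⟨by linarith, by linarith⟩),
      Set.piecewise_eq_of_mem _ _ _ (Set.mem_Icc.2 ⟨by linarith, by linarith⟩)]
  · rw [hout fun hx => hx.1.not_ge ha0, h.apply_zero]
  · rw [hout fun hx => hx.2.not_ge hb1, h.apply_one]

end IsAdversaryState

theorem exists_disjoint_Icc_mem_middle_third {N : ℕ} (hN : 0 < N) {a b : ℝ} (hab : a < b) :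
    ∃ l r : Fin N → ℝ, (∀ i, r i - l i = (b - a) * (1 / (6 * N))) ∧
      (∀ i, (b - a) / 3 ≤ l i - a) ∧ (∀ i, (b - a) / 3 ≤ b - r i) ∧
      Pairwise fun i j => Disjoint (Set.Icc (l i) (r i)) (Set.Icc (l j) (r j)) := by
  have : (0 : ℝ) < N := by exact_mod_cast hN
  set w := (b - a) * (1 / (6 * N)) with hw
  have : 0 < w := mul_pos (sub_pos.2 hab) (by positivity)
  have hNw : N * w = (b - a) / 6 := by rw [hw]; field_simp
  refine ⟨fun i => a + (b - a) / 3 + 2 * i * w, fun i => a + (b - a) / 3 + (2 * i + 1) * w,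
    fun i => by ring, fun i => ?_, fun i => ?_, (pairwise_disjoint_on _).2 fun i j hij => ?_⟩
  · have : 0 ≤ 2 * i * w := by positivity
    linarith
  · have hi : (i : ℝ) + 1 ≤ N := by exact_mod_cast i.2
    nlinarith
  · have hij' : (i : ℝ) + 1 ≤ j := by exact_mod_cast hij
    exact Set.disjoint_left.2 fun x hxi hxj => (by nlinarith [hxi.2, hxj.1] : False)

theorem iterates_congr {R : Type*} {O : (ℝ → ℝ) → ℝ → R} (hO : IsLocalOracle O)
    (A : (t : ℕ) → (Fin t → R) → ℝ) {f g : ℝ → ℝ} {t : ℕ}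
    (hfg : ∀ s < t, f =ᶠ[𝓝 (iterates O A f s)] g) : iterates O A f t = iterates O A g t := by
  induction t using Nat.strong_induction_on with
  | _ t ih =>
    rw [iterates, iterates]
    congr 1
    funext s
    rw [← ih s s.2 fun r hr => hfg r (hr.trans s.2)]
    exact hO _ _ _ (hfg s s.2)

theorem exists_iterates_mem_or_of_eqOn_compl {R : Type*} {O : (ℝ → ℝ) → ℝ → R}
    (hO : IsLocalOracle O) (A : (t : ℕ) → (Fin t → R) → ℝ) {f g : ℝ → ℝ} {K L : Set ℝ} {t : ℕ}
    (hK : IsClosed K) (hLK : L ⊆ K) (hgf : Set.EqOn g f Kᶜ)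
    (hg : ∃ s < t + 1, iterates O A g s ∈ L) :
    (∃ s < t, iterates O A f s ∈ K) ∨ iterates O A f t ∈ L := by
  obtain ⟨s, hs, hmem⟩ := hg
  by_cases hhit : ∃ r < t, iterates O A f r ∈ K
  · exact Or.inl hhit
  push Not at hhit
  have heq : iterates O A f s = iterates O A g s :=
    iterates_congr hO A fun r hr => hgf.symm.eventuallyEq_of_mem
      (hK.isOpen_compl.mem_nhds (hhit r (hr.trans_le (Nat.le_of_lt_succ hs))))
  rw [← heq] at hmem
  rcases (Nat.le_of_lt_succ hs).lt_or_eq with hst | rfl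
  · exact absurd (hLK hmem) (hhit s hst)
  · exact Or.inr hmem

section Adversary

open MeasureTheory

theorem exists_measure_le_div_card {Ω ι : Type*} [MeasurableSpace Ω] [Fintype ι] [Nonempty ι]
    {μ : Measure Ω} {E : ι → Set Ω} (hE : ∀ i, NullMeasurableSet (E i) μ)
    (hdisj : Pairwise fun i j => AEDisjoint μ (E i) (E j)) :
    ∃ i, μ (E i) ≤ μ Set.univ / Fintype.card ι := by
  have hsum : ∑ i, μ (E i) ≤ ∑ _i : ι, μ Set.univ / Fintype.card ι := by
    rw [Finset.sum_const, Finset.card_univ, nsmul_eq_mul,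
      ENNReal.mul_div_cancel (by simp) (by simp)]
    exact sum_measure_le_measure_univ (fun i _ => hE i) fun i _ j _ hij => hdisj hij
  obtain ⟨i, -, hi⟩ := ENNReal.exists_le_of_sum_le Finset.univ_nonempty hsum
  exact ⟨i, hi⟩

variable {R Ω : Type*} [MeasurableSpace Ω] {O : (ℝ → ℝ) → ℝ → R} {μ : Measure Ω}
  [IsProbabilityMeasure μ] {A : (t : ℕ) → Ω → (Fin t → R) → ℝ} {f : ℝ → ℝ} {a b : ℝ}
  {N t : ℕ}

theorem IsAdversaryState.exists_step (h : IsAdversaryState f a b) (hO : IsLocalOracle O)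
    (hN : 0 < N) (hmeas : AEMeasurable (fun ω => iterates O (fun s => A s ω) f t) μ) :
    ∃ g a' b', IsAdversaryState g a' b' ∧ b' - a' = (b - a) * (1 / (6 * N)) ∧
      μ {ω | ∃ s < t + 1, iterates O (fun s => A s ω) g s ∈ Set.Icc a' b'} ≤
        μ {ω | ∃ s < t, iterates O (fun s => A s ω) f s ∈ Set.Icc a b} + 1 / N := by
  have : Nonempty (Fin N) := ⟨⟨0, hN⟩⟩
  obtain ⟨l, r, hlen, hl, hr, hdisj⟩ := exists_disjoint_Icc_mem_middle_third hN h.left_lt_right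
  obtain ⟨i, hi⟩ : ∃ i, μ {ω | iterates O (fun s => A s ω) f t ∈ Set.Icc (l i) (r i)} ≤ 1 / N := by
    have h := exists_measure_le_div_card (μ := μ)
      (fun i => hmeas.nullMeasurableSet_preimage measurableSet_Icc)
      fun i j hij => ((hdisj hij).preimage _).aedisjoint
    rwa [measure_univ, Fintype.card_fin] at h
  have hlt : l i < r i := by
    have : 0 < (b - a) * (1 / (6 * N)) := mul_pos (sub_pos.2 h.left_lt_right) (by positivity)
    linarith [hlen i]
  obtain ⟨g, hg, hgf⟩ := h.exists_refinement hlt (hl i) (hr i)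
  refine ⟨g, l i, r i, hg, hlen i, ?_⟩
  have hsub : Set.Icc (l i) (r i) ⊆ Set.Icc a b :=
    Set.Icc_subset_Icc (by linarith [hl i, h.left_lt_right]) (by linarith [hr i, h.left_lt_right])
  exact (measure_mono fun ω hω =>
    exists_iterates_mem_or_of_eqOn_compl hO (fun s => A s ω) isClosed_Icc hsub hgf hω).trans
      ((measure_union_le _ _).trans (add_le_add_right hi _))

theorem exists_isAdversaryState (hO : IsLocalOracle O) (hN : 0 < N)
    (hmeas : ∀ f : ℝ → ℝ, (∃ K, LipschitzWith K f) → BddBelow (Set.range f) →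
      ∀ s < t, AEMeasurable (fun ω => iterates O (fun s => A s ω) f s) μ) :
    ∃ f a b, IsAdversaryState f a b ∧ b - a = (1 / (6 * N)) ^ t ∧
      μ {ω | ∃ s < t, iterates O (fun s => A s ω) f s ∈ Set.Icc a b} ≤ t / N := by
  induction t with
  | zero => exact ⟨_, 0, 1, IsAdversaryState.initial, by simp, by simp⟩
  | succ t ih =>
    obtain ⟨f, a, b, hf, hlen, hprob⟩ := ih fun f hf hf' s hs => hmeas f hf hf' s (by omega)
    obtain ⟨g, a', b', hg, hlen', hprob'⟩ := hf.exists_step hO hN <|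
      hmeas f ⟨2, hf.isSteepValley.lipschitzWith⟩
        ⟨0, Set.forall_mem_range.2 hf.apply_nonneg⟩ t t.lt_succ_self
    refine ⟨g, a', b', hg, by rw [hlen', hlen, pow_succ], hprob'.trans ?_⟩
    rw [Nat.cast_succ, ENNReal.add_div]
    gcongr

end Adversary

theorem mainTheorem6 (T : ℕ) (δ : ℝ) (hδ : 0 < δ) :
    ∃ ρ : ℝ, 0 < ρ ∧
      -- a local oracle with responses in an arbitrary set `R`
      ∀ {R : Type*} (O : (ℝ → ℝ) → ℝ → R), IsLocalOracle O →
      -- a randomized algorithm with its seed drawn from an arbitrary probability space `(Ω, μ)`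
      ∀ {Ω : Type*} [MeasurableSpace Ω] (μ : MeasureTheory.Measure Ω)
        [MeasureTheory.IsProbabilityMeasure μ] (A : (t : ℕ) → Ω → (Fin t → R) → ℝ),
      -- on every Lipschitz objective bounded from below, the iterates are random variables
      (∀ f : ℝ → ℝ, (∃ K, LipschitzWith K f) → BddBelow (Set.range f) →
        ∀ t < T, AEMeasurable (fun ω => iterates O (fun s => A s ω) f t) μ) →
      ∃ (h : ℝ → ℝ) (xstar : ℝ),
        (∀ x, 0 ≤ h x) ∧ LipschitzWith 2 h ∧ h 0 = 1 ∧
        xstar ∈ Set.Ioo (0 : ℝ) 1 ∧ (∀ x, x ≠ xstar → h xstar < h x) ∧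
        (∀ x, x ≠ xstar → ∀ g ∈ clarkeDeriv h x, 1 ≤ |g|) ∧
        μ.real {ω | ∃ t < T, |iterates O (fun s => A s ω) h t - xstar| < ρ} < δ := by
  obtain ⟨N, hTN⟩ := exists_nat_gt ((T : ℝ) / δ)
  have hNpos : (0 : ℝ) < N := lt_of_le_of_lt (by positivity) hTN
  refine ⟨(1 / (6 * N)) ^ T / 2, by positivity, ?_⟩
  intro R O hO Ω _ μ _ A hmeas
  obtain ⟨h, a, b, hstate, hlen, hprob⟩ :=
    exists_isAdversaryState hO (Nat.cast_pos.1 hNpos) hmeas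
  have hvalley := hstate.isSteepValley
  refine ⟨h, (a + b) / 2, hstate.apply_nonneg, hvalley.lipschitzWith, hstate.apply_zero,
    hstate.midpoint_mem_Ioo, fun _ => hvalley.apply_lt,
    fun _ hx _ => hvalley.one_le_abs_of_mem_clarkeDeriv hx, ?_⟩
  have hnear {x : ℝ} (hx : |x - (a + b) / 2| < (1 / (6 * N)) ^ T / 2) : x ∈ Set.Icc a b := by
    rw [← hlen, abs_lt] at hx
    constructor <;> linarith
  calc μ.real {ω | ∃ t < T, |iterates O (fun s => A s ω) h t - (a + b) / 2| < _}
    _ ≤ μ.real {ω | ∃ t < T, iterates O (fun s => A s ω) h t ∈ Set.Icc a b} :=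
        MeasureTheory.measureReal_mono fun ω ⟨t, ht, hx⟩ => ⟨t, ht, hnear hx⟩
    _ ≤ T / N := by
        refine ENNReal.toReal_le_of_le_ofReal (by positivity) (hprob.trans_eq ?_)
        rw [ENNReal.ofReal_div_of_pos hNpos, ENNReal.ofReal_natCast, ENNReal.ofReal_natCast]
    _ < δ := (div_lt_comm₀ hδ hNpos).1 hTN
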